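/- **Setting.** For each $d\ge 1$ consider a network of $d$ stations. Jobs arrive at rate $\lambda=\lambda_d>0$ (a Poisson process); the $k$-th job brings the work vector $\mathbf W(k)\in[0,\infty)^d$; the vectors $\mathbf W(k)$ are i.i.d. copies of $\mathbf W$ and independent of the arrivals. Let $\mathbf r=\mathbf r_d\in\mathbb R^d$ be the service rates and let $Q=Q_d$ be a substochastic routing matrix with zero diagonal and $Q^n\to0$. Put $R=(I-Q)^T$, let $\mathbf J(t)$ be the sum of the work vectors that arrived by time $t$, and $\mathbf X(t)=\mathbf J(t)-tR\mathbf r$. Let $\mathbf Z(t)=\mathbf J(t)-t\mathbf v$, where the drift vector $\mathbf v=\mathbf v_d$ is either $\mathbf v=\mathbf r$ or $\mathbf v=R\mathbf r+\mathbf z$ with $\mathbf z=E\mathbf X(1)+\eta\mathbf 1$, $0<\eta R^{-1}\mathbf 1<-R^{-1}E\mathbf X(1)$ componentwise and $\eta\ge\delta_0$, where $\eta=\eta_d$ and $\delta_0$ is the constant of C1. Suppose that for every $i$ there is $\theta_i^*>0$ (necessarily unique) with $E\exp(\theta_i^*Z_i(1))=1$. Put $m=2\log d/\min_i\theta_i^*$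 and $w_k=e^{-\theta_k^*m}/\sum_je^{-\theta_j^*m}$. **Algorithm.** 1. Set $\tau=0$, $\mathbf Z(0)=\mathbf 0$, $N=0$. 2. Draw $\mathbf W$ and, independently, $U\sim\mathrm{Exp}(\lambda)$. Set $\mathbf Z(\tau+U)=\mathbf Z(\tau)+\mathbf W-U\mathbf v$, $\tau\leftarrow\tau+U$, $N\leftarrow N+1$. 3. If $W_i-Uv_i\ge-m$ for some $i$, return to 2. 4. Otherwise draw $K$ with $P(K=k)=w_k$. Given $K=k$, draw i.i.d. pairs $(\mathbf W'(n),U'(n))$ with independent entries, where $\mathbf W'(n)$ has density $e^{\theta_k^*W_k}/Ee^{\theta_k^*W_k}$ with respect to the law of $\mathbf W$ and $U'(n)\sim\mathrm{Exp}(\lambda Ee^{\theta_k^*W_k})$. Run $\mathbf C(n)=\sum_{j\le n}(\mathbf W'(j)-U'(j)\mathbf v)$ up to $N_m=\inf\{n\ge0:C_i(n)>m\text{ for some }i\}$. 5. Set $N\leftarrow N+N_m$ and draw a Bernoulli variable $I$ with success probability $1/\sum_kw_k\exp(\theta_k^*C_k(N_m))$. If $I=1$, set $\mathbf Z(\tau+\sum_{j\le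 N_m}U'(j))=\mathbf Z(\tau)+\mathbf C(N_m)$ and $\tau\leftarrow\tau+\sum_{j\le N_m}U'(j)$, and return to 2. 6. If $I=0$, stop. All draws are independent except as stated. Let $N(d)$ be the final value of $N$ (it is $\infty$ if the algorithm does not stop); it counts the simulated random vectors. **Theorem.** Let $\delta_0,a,H,\alpha,\zeta\in(0,\infty)$. There is an exponent $\gamma$, depending only on these five constants, such that for every sequence of networks as above that satisfies, for all $d\ge1$, * C1) $R^{-1}E\mathbf X(1)<-\delta_0\mathbf 1$ componentwise; * C2) $E[Z_i(1)^2]\le a$ for all $i$, and for every $j\le d$ there is $\delta_j>\theta_j^*+\alpha$ (possibly depending on $d$) with $E\exp(\delta_jW_j)\le H$; * C3) $\zeta\le\lambda_d\le1/\zeta$, we have $E[N(d)]<\infty$ for all large $d$, and $E[N(d)]=O(d^\gamma)$ as $d\to\infty$. -/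

import Mathlib

open MeasureTheory ProbabilityTheory Filter Asymptotics

noncomputable section

/-- A stochastic fluid network with `d` stations and compound Poisson input: jobs arrive at rate
`rate`, the requirement vectors `W(k)` of the jobs are i.i.d. with law `jobLaw`, `r i` is the
service rate of station `i`, and a proportion `Q i j` of the fluid processed by station `i` is
routed to station `j`. The network is open: `Q ^ n → 0`. -/
structure FluidNetwork (d : ℕ) where
  rate : ℝ
  rate_pos : 0 < rate
  jobLaw : Measure (Fin d → ℝ)
  isProb : IsProbabilityMeasure jobLaw
  job_nonneg : ∀ᵐ w ∂jobLaw, ∀ i, 0 ≤ w i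
  Q : Matrix (Fin d) (Fin d) ℝ
  Q_nonneg : ∀ i j, 0 ≤ Q i j
  Q_sum_le_one : ∀ i, ∑ j, Q i j ≤ 1
  Q_diag : ∀ i, Q i i = 0
  Q_pow_tendsto : ∀ i j, Tendsto (fun n : ℕ => (Q ^ n) i j) atTop (nhds 0)
  r : Fin d → ℝ

namespace FluidNetwork

variable {d : ℕ}

instance (S : FluidNetwork d) : IsProbabilityMeasure S.jobLaw := S.isProb

/-- The reflection matrix `R = (I - Q)ᵀ`. -/
def R (S : FluidNetwork d) : Matrix (Fin d) (Fin d) ℝ := (1 - S.Q).transpose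

/-- The joint law of the job requirements `W(1), W(2), …` (i.i.d.) and of the number of arrivals
in `[0, t]`, which is independent of them and Poisson with mean `rate * t`. -/
def inputLaw (S : FluidNetwork d) (t : ℝ) : Measure ((ℕ → Fin d → ℝ) × ℕ) :=
  (Measure.infinitePi fun _ : ℕ => S.jobLaw).prod (poissonMeasure (S.rate * t).toNNReal)

/-- The value at time `t` of the compound Poisson input with the drift `-v`:
`J(t) - t v`, where `J(t)` is the sum of the requirements of the jobs that arrived by time `t`.
It is a random vector under `inputLaw t`. -/
def netInput (v : Fin d → ℝ) (t : ℝ) (p : (ℕ → Fin d → ℝ) × ℕ) : Fin d → ℝ :=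
  (∑ k ∈ Finset.range p.2, p.1 k) - t • v

/-- `E X(1)`, where `X(t) = J(t) - t R r`. -/
def meanX (S : FluidNetwork d) : Fin d → ℝ :=
  fun i => ∫ p, netInput (S.R.mulVec S.r) 1 p i ∂(S.inputLaw 1)

/-- The drift vectors `v` of `Z(t) = J(t) - t v` with which the algorithm is run: the vector `r`
of service rates, or the vector `R r + z` of the dominating process, where
`z = E X(1) + η (1, …, 1)` with `0 < η R⁻¹ (1, …, 1) < - R⁻¹ E X(1)` and `η ≥ δ₀`. -/
def IsDrift (S : FluidNetwork d) (δ₀ : ℝ) (v : Fin d → ℝ) : Prop :=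
  v = S.r ∨
    ∃ η : ℝ, δ₀ ≤ η ∧
      (∀ i, 0 < (η • S.R⁻¹.mulVec (fun _ => 1)) i ∧
        (η • S.R⁻¹.mulVec (fun _ => 1)) i < -(S.R⁻¹.mulVec S.meanX) i) ∧
      v = S.R.mulVec S.r + (S.meanX + fun _ => η)

/-- Cramér's condition for `Z(t) = J(t) - t v`: `θ i` is a positive root of
`E exp (θ i * Z i (1)) = 1`. (There is at most one such root, by strict convexity.) -/
def IsCramerRoot (S : FluidNetwork d) (v θ : Fin d → ℝ) : Prop :=
  ∀ i, 0 < θ i ∧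
    Integrable (fun p => Real.exp (θ i * netInput v 1 p i)) (S.inputLaw 1) ∧
    ∫ p, Real.exp (θ i * netInput v 1 p i) ∂(S.inputLaw 1) = 1

/-! ### The sampling algorithm -/

/-- The level `m = 2 log d / min θ`, for which `∑ i, exp (- θ i * m) ≤ 1 / d`. -/
def level (θ : Fin d → ℝ) : ℝ := 2 * Real.log d / ⨅ i, θ i

/-- The mixture weights `w k = exp (- θ k * m) / ∑ j, exp (- θ j * m)`. -/
def weight (θ : Fin d → ℝ) (k : Fin d) : ℝ :=
  Real.exp (-(θ k * level θ)) / ∑ j, Real.exp (-(θ j * level θ))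

/-- `φ(0, …, θ k, …, 0) = E exp (θ k * W k)`. -/
def jobMgf (S : FluidNetwork d) (θ : Fin d → ℝ) (k : Fin d) : ℝ :=
  ∫ w, Real.exp (θ k * w k) ∂S.jobLaw

/-- The law of `(W', U')` under the proposal distribution, given `K = k`: the law of `W'` has the
density `exp (θ k * w k) / φ` with respect to the law of `W`, and `U'` is independent of `W'` and
exponential with rate `rate * φ`. -/
def tiltedPairLaw (S : FluidNetwork d) (θ : Fin d → ℝ) (k : Fin d) :
    Measure ((Fin d → ℝ) × ℝ) :=
  (S.jobLaw.tilted fun w => θ k * w k).prod (expMeasure (S.rate * S.jobMgf θ k))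

/-- The joint law of the index `K`, chosen with the probabilities `weight θ`, and of the sequence
of pairs `(W'(n), U'(n))`, which given `K = k` are i.i.d. with law `tiltedPairLaw θ k`. -/
def proposalLaw (S : FluidNetwork d) (θ : Fin d → ℝ) :
    Measure (Fin d × (ℕ → (Fin d → ℝ) × ℝ)) :=
  ∑ k, ENNReal.ofReal (weight θ k) •
    (Measure.dirac k).prod (Measure.infinitePi fun _ : ℕ => S.tiltedPairLaw θ k)

/-- The randomness available in one pass through the loop of the algorithm. -/
structure Draw (d : ℕ) where
  /-- The job requirements drawn in Step 2. -/
  W : Fin d → ℝ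
  /-- The inter-arrival time drawn in Step 2. -/
  U : ℝ
  /-- The mixture index of the proposal. -/
  K : Fin d
  /-- The pairs `(W'(n), U'(n))` of the proposal walk of Step 4. -/
  pairs : ℕ → (Fin d → ℝ) × ℝ
  /-- The uniform variable that realizes the Bernoulli variable of Step 5. -/
  V : ℝ

/-- The space on which the law of a draw lives. -/
abbrev DrawSpace (d : ℕ) : Type :=
  ((Fin d → ℝ) × ℝ) × ((Fin d × (ℕ → (Fin d → ℝ) × ℝ)) × ℝ)

/-- The draw with given coordinates. -/
def DrawSpace.toDraw (x : DrawSpace d) : Draw d :=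
  ⟨x.1.1, x.1.2, x.2.1.1, x.2.1.2, x.2.2⟩

/-- The law of one draw: `W` and `U` are independent with laws `jobLaw` and `Exp(rate)`, and they
are independent of the proposal and of the uniform variable on `[0, 1]`. -/
def drawLaw (S : FluidNetwork d) (θ : Fin d → ℝ) : Measure (DrawSpace d) :=
  (S.jobLaw.prod (expMeasure S.rate)).prod
    ((S.proposalLaw θ).prod (volume.restrict (Set.Icc (0 : ℝ) 1)))

/-- The law of the draws for the successive passes, which are i.i.d. -/
def drawsLaw (S : FluidNetwork d) (θ : Fin d → ℝ) : Measure (ℕ → DrawSpace d) :=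
  Measure.infinitePi fun _ : ℕ => S.drawLaw θ

/-- The proposal walk `C(n) = ∑ (W'(j) - U'(j) v)`. -/
def walk (v : Fin d → ℝ) (x : Draw d) (n : ℕ) : Fin d → ℝ :=
  ∑ j ∈ Finset.range n, ((x.pairs j).1 - (x.pairs j).2 • v)

open Classical in
/-- `N_m = inf {n ≥ 0 : C i (n) > m for some i}`, which is `⊤` if there is no such `n`. -/
def crossing (v θ : Fin d → ℝ) (x : Draw d) : ℕ∞ :=
  if h : ∃ n : ℕ, ∃ i, level θ < walk v x n i then (Nat.find h : ℕ∞) else ⊤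

/-- The acceptance probability `1 / ∑ k, w k * exp (θ k * C k (N_m))`. -/
def acceptProb (v θ : Fin d → ℝ) (x : Draw d) : ℝ :=
  1 / ∑ k, weight θ k * Real.exp (θ k * walk v x (crossing v θ x).toNat k)

/-- The state of the algorithm: the current time `τ`, the current value `Z(τ)`, the number `N` of
random vectors generated so far, and whether it has stopped. -/
structure State (d : ℕ) where
  time : ℝ
  pos : Fin d → ℝ
  count : ℕ∞
  halted : Bool

/-- Step 1. -/
def State.init (d : ℕ) : State d := ⟨0, 0, 0, false⟩

open Classical in
/-- One pass through Steps 2 to 6. A proposal walk that never crosses the level contributes `⊤` to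
the count, and a draw that is not asked for is not counted. -/
def pass (v θ : Fin d → ℝ) (x : Draw d) (s : State d) : State d :=
  if s.halted then s
  else
    -- Step 2
    let τ := s.time + x.U
    let Z := s.pos + (x.W - x.U • v)
    let N := s.count + 1
    -- Step 3
    if ∃ i, -level θ ≤ x.W i - x.U * v i then ⟨τ, Z, N, false⟩
    else
      -- Steps 4 and 5
      let Nm := crossing v θ x
      if x.V ≤ acceptProb v θ x then
        ⟨τ + ∑ j ∈ Finset.range Nm.toNat, (x.pairs j).2, Z + walk v x Nm.toNat, N + Nm, false⟩
      -- Step 6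
      else ⟨τ, Z, N + Nm, true⟩

/-- The state after `n` passes. -/
def run (v θ : Fin d → ℝ) (ω : ℕ → DrawSpace d) : ℕ → State d
  | 0 => State.init d
  | n + 1 => pass v θ (ω n).toDraw (run v θ ω n)

/-- The number `N` of random vectors that the algorithm generates until it stops
(it is `⊤` if the algorithm does not stop, since each pass increases the count). -/
def totalCount (v θ : Fin d → ℝ) (ω : ℕ → DrawSpace d) : ℕ∞ :=
  ⨆ n, (run v θ ω n).count

/-- The expectation `E[N]`. -/
def expectedCount (S : FluidNetwork d) (v θ : Fin d → ℝ) : ENNReal :=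
  ∫⁻ ω, (totalCount v θ ω : ENNReal) ∂(S.drawsLaw θ)

/-! ### The laws above are probability measures -/

lemma jobMgf_pos (S : FluidNetwork d) (θ : Fin d → ℝ) (k : Fin d)
    (h : Integrable (fun w => Real.exp (θ k * w k)) S.jobLaw) : 0 < S.jobMgf θ k :=
  integral_exp_pos h

lemma isProbabilityMeasure_tiltedPairLaw (S : FluidNetwork d) (θ : Fin d → ℝ) (k : Fin d)
    (h : Integrable (fun w => Real.exp (θ k * w k)) S.jobLaw) :
    IsProbabilityMeasure (S.tiltedPairLaw θ k) := by
  have h1 := isProbabilityMeasure_tilted h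
  have h2 := isProbabilityMeasure_expMeasure (mul_pos S.rate_pos (S.jobMgf_pos θ k h))
  unfold tiltedPairLaw
  infer_instance

lemma sum_weight [NeZero d] (θ : Fin d → ℝ) : ∑ k, weight θ k = 1 := by
  have : 0 < ∑ j : Fin d, Real.exp (-(θ j * level θ)) :=
    Finset.sum_pos (fun _ _ => Real.exp_pos _) ⟨0, Finset.mem_univ _⟩
  simp only [weight]
  rw [← Finset.sum_div, div_self this.ne']

lemma weight_nonneg (θ : Fin d → ℝ) (k : Fin d) : 0 ≤ weight θ k := by
  unfold weight; positivity

lemma isProbabilityMeasure_drawLaw [NeZero d] (S : FluidNetwork d) (θ : Fin d → ℝ)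
    (h : ∀ k, Integrable (fun w => Real.exp (θ k * w k)) S.jobLaw) :
    IsProbabilityMeasure (S.drawLaw θ) := by
  have h1 := fun k => S.isProbabilityMeasure_tiltedPairLaw θ k (h k)
  have h2 : IsProbabilityMeasure (S.proposalLaw θ) := by
    constructor
    unfold proposalLaw
    simp only [Measure.finsetSum_apply, Measure.smul_apply, measure_univ, smul_eq_mul, mul_one]
    rw [← ENNReal.ofReal_sum_of_nonneg fun k _ => weight_nonneg θ k, sum_weight]
    simp
  have h3 := isProbabilityMeasure_expMeasure S.rate_pos
  have h4 : IsProbabilityMeasure (volume.restrict (Set.Icc (0 : ℝ) 1)) := ⟨by simp⟩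
  unfold drawLaw
  infer_instance

end FluidNetwork

end

noncomputable section

/-! ### Moments under product, exponential and compound Poisson laws. -/

section General

/-! Each pass stops with probability at least an inverse power of `d` and costs on average at most a
power of `d`. Since the passes are independent, the mean total cost is at most the second bound
divided by the first (`FluidNetwork.expectedCount_le`).

Stopping: by Markov and a union bound, all `W i` are at most a `B` of order `log d` with probability
at least 1/2. As `v i ≥ δ₀`, an inter-arrival time above `T = (m + B) / δ₀` then forces every
coordinate below `-m`, and it has probability `exp (-rate * T)`, a power of `d`. When the proposal
walk crosses, the acceptance probability is at most `1 / d`, so the proposal is rejected with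
probability at least 1/2 (`Regular.le_measure_haltSet`).

Cost: under the tilt by `θ k`, the `k`-th coordinate drifts upwards. A Chernoff bound with exponent
`θ k - u` turns the tilted transform into the original one at `u`. At a small `u` fixed by the
constants, the drift gap `δ₀` makes this transform at most `1 - stepGap`, so the mean number of
steps below `m` is at most `exp (θ k * m) / stepGap` (`Regular.lintegral_belowCount_le`).

The exponents are uniform because the Cramér roots lie between two positive constants
(`Regular.rootBound_lt`, `Regular.root_le_const`), so `m = O(log d)`. Both bounds rest on the gap
`δ₀ + rate * E W i ≤ v i`, which C1 gives for either choice of drift (`IsDrift.add_le`). -/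

lemma lintegral_infinitePi_prod_range {X : Type*} [MeasurableSpace X] (μ : Measure X)
    [IsProbabilityMeasure μ] (f : ℕ → X → ENNReal) (hf : ∀ j, Measurable (f j)) (n : ℕ) :
    ∫⁻ ω, ∏ j ∈ Finset.range n, f j (ω j) ∂(Measure.infinitePi fun _ : ℕ => μ) =
      ∏ j ∈ Finset.range n, ∫⁻ x, f j x ∂μ := by
  have h := lintegral_prod_eq_prod_lintegral_of_indepFun (Finset.range n)
    (fun j (ω : ℕ → X) => f j (ω j)) (iIndepFun_infinitePi (P := fun _ : ℕ => μ) hf)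
    (fun j => (hf j).comp (measurable_pi_apply j))
  rw [h]
  refine Finset.prod_congr rfl fun j _ => ?_
  exact (measurePreserving_eval_infinitePi (fun _ : ℕ => μ) j).lintegral_comp (hf j)

lemma integral_infinitePi_eval {X : Type*} [MeasurableSpace X] (μ : Measure X)
    [IsProbabilityMeasure μ] {g : X → ℝ} (hg : Measurable g) (k : ℕ) :
    ∫ ω : ℕ → X, g (ω k) ∂(Measure.infinitePi fun _ : ℕ => μ) = ∫ x, g x ∂μ := by
  have h := (measurePreserving_eval_infinitePi (fun _ : ℕ => μ) k)
  have h2 := integral_map (μ := Measure.infinitePi fun _ : ℕ => μ) h.measurable.aemeasurable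
    (f := g) hg.aestronglyMeasurable
  rw [h.map_eq] at h2
  exact h2.symm

lemma lintegral_exp_mul_expMeasure {r c : ℝ} (hr : 0 < r) (hc : c < r) :
    ∫⁻ u, ENNReal.ofReal (Real.exp (c * u)) ∂(expMeasure r) = ENNReal.ofReal (r / (r - c)) := by
  have hrc : 0 < r - c := sub_pos.2 hc
  have hm : Measurable (gammaPDF 1 r) := (measurable_gammaPDFReal 1 r).ennreal_ofReal
  rw [expMeasure, gammaMeasure, lintegral_withDensity_eq_lintegral_mul _ hm (by fun_prop)]
  calc ∫⁻ u, (gammaPDF 1 r * fun u => ENNReal.ofReal (Real.exp (c * u))) u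
      = ∫⁻ u, ENNReal.ofReal (r / (r - c)) * exponentialPDF (r - c) u := by
        refine lintegral_congr fun u => ?_
        simp only [Pi.mul_apply]
        change exponentialPDF r u * _ = _
        rw [exponentialPDF_eq, exponentialPDF_eq]
        split_ifs with h
        · rw [← ENNReal.ofReal_mul (by positivity), ← ENNReal.ofReal_mul (by positivity)]
          congr 1
          have : Real.exp (-((r - c) * u)) = Real.exp (-(r * u)) * Real.exp (c * u) := by
            rw [← Real.exp_add]; ring_nf
          rw [this]; field_simp
        · simp
    _ = ENNReal.ofReal (r / (r - c)) := by
        rw [lintegral_const_mul' _ _ ENNReal.ofReal_ne_top, lintegral_exponentialPDF_eq_one hrc,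
          mul_one]

lemma expMeasure_Ioi {r : ℝ} (hr : 0 < r) {t : ℝ} (ht : 0 ≤ t) :
    expMeasure r (Set.Ioi t) = ENNReal.ofReal (Real.exp (-(r * t))) := by
  have := isProbabilityMeasure_expMeasure hr
  rw [← Set.compl_Iic, prob_compl_eq_one_sub measurableSet_Iic, ← ofReal_cdf,
    cdf_expMeasure_eq hr, if_pos ht, ← ENNReal.ofReal_one,
    ← ENNReal.ofReal_sub _ (sub_nonneg.2 (Real.exp_le_one_iff.2 (by nlinarith)))]
  ring_nf

lemma integral_pow_poissonMeasure (r : NNReal) (x : ℝ) :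
    ∫ n, x ^ n ∂(poissonMeasure r) = Real.exp (r * (x - 1)) := by
  rw [integral_poissonMeasure]
  have h : ∀ n : ℕ, (Real.exp (-r) * (r : ℝ) ^ n / (n.factorial : ℝ)) • x ^ n
      = Real.exp (-r) * (((r : ℝ) * x) ^ n / n.factorial) := by
    intro n; rw [mul_pow, smul_eq_mul]; ring
  simp_rw [h]
  rw [tsum_mul_left, (NormedSpace.expSeries_div_hasSum_exp ((r : ℝ) * x)).tsum_eq,
    ← Real.exp_eq_exp_ℝ, ← Real.exp_add]
  ring_nf

lemma hasSum_natCast_poissonMeasure (r : NNReal) :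
    HasSum (fun n : ℕ => Real.exp (-r) * (r : ℝ) ^ n / (n.factorial : ℝ) * n) (r : ℝ) := by
  -- The term at 0 vanishes; shifting the index cancels the factor `n` against the factorial.
  rw [← hasSum_nat_add_iff' 1]
  have h := (hasSum_one_poissonMeasure r).mul_left (r : ℝ)
  rw [mul_one] at h
  simp only [Finset.range_one, Finset.sum_singleton, CharP.cast_eq_zero, mul_zero, sub_zero]
  refine h.congr_fun fun n => ?_
  rw [Nat.factorial_succ]
  push_cast
  field_simp
  ring

lemma integrable_natCast_poissonMeasure (r : NNReal) :
    Integrable (fun n : ℕ => (n : ℝ)) (poissonMeasure r) := by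
  rw [integrable_poissonMeasure_iff]
  simpa using (hasSum_natCast_poissonMeasure r).summable

lemma integral_natCast_poissonMeasure (r : NNReal) :
    ∫ n, (n : ℝ) ∂(poissonMeasure r) = r := by
  rw [integral_poissonMeasure]
  simpa using (hasSum_natCast_poissonMeasure r).tsum_eq

/-- The mean of a compound Poisson sum. -/
lemma integral_compoundPoisson {X : Type*} [MeasurableSpace X] (μ : Measure X)
    [IsProbabilityMeasure μ] (r : NNReal) (f : X → ℝ) (hfm : Measurable f) (hf : Integrable f μ) :
    Integrable (fun p : (ℕ → X) × ℕ => ∑ k ∈ Finset.range p.2, f (p.1 k))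
      ((Measure.infinitePi fun _ : ℕ => μ).prod (poissonMeasure r)) ∧
    ∫ p : (ℕ → X) × ℕ, ∑ k ∈ Finset.range p.2, f (p.1 k)
      ∂((Measure.infinitePi fun _ : ℕ => μ).prod (poissonMeasure r)) = r * ∫ x, f x ∂μ := by
  have hk (k : ℕ) : Integrable (fun ω : ℕ → X => f (ω k)) (Measure.infinitePi fun _ : ℕ => μ) :=
    (measurePreserving_eval_infinitePi (fun _ : ℕ => μ) k).integrable_comp_of_integrable hf
  have hki (g : X → ℝ) (hg : Measurable g) (k : ℕ) :
      ∫ ω : ℕ → X, g (ω k) ∂(Measure.infinitePi fun _ : ℕ => μ) = ∫ x, g x ∂μ :=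
    integral_infinitePi_eval μ hg k
  have hmeas : Measurable (fun p : (ℕ → X) × ℕ => ∑ k ∈ Finset.range p.2, f (p.1 k)) :=
    measurable_from_prod_countable_left fun n =>
      Finset.measurable_fun_sum (Finset.range n) fun k _ => hfm.comp (measurable_pi_apply k)
  have hint : Integrable (fun p : (ℕ → X) × ℕ => ∑ k ∈ Finset.range p.2, f (p.1 k))
      ((Measure.infinitePi fun _ : ℕ => μ).prod (poissonMeasure r)) := by
    rw [integrable_prod_iff' hmeas.aestronglyMeasurable]
    refine ⟨ae_of_all _ fun n => integrable_finsetSum (Finset.range n) fun k _ => hk k, ?_⟩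
    refine ((integrable_natCast_poissonMeasure r).mul_const (∫ x, ‖f x‖ ∂μ)).mono'
      Measurable.of_discrete.aestronglyMeasurable (ae_of_all _ fun n => ?_)
    rw [Real.norm_of_nonneg (integral_nonneg fun _ => norm_nonneg _)]
    calc ∫ ω : ℕ → X, ‖∑ k ∈ Finset.range n, f (ω k)‖ ∂(Measure.infinitePi fun _ : ℕ => μ)
        ≤ ∫ ω : ℕ → X, ∑ k ∈ Finset.range n, ‖f (ω k)‖ ∂(Measure.infinitePi fun _ : ℕ => μ) :=
          integral_mono (integrable_finsetSum _ fun k _ => hk k).norm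
            (integrable_finsetSum _ fun k _ => (hk k).norm) fun ω => norm_sum_le _ _
      _ = n * ∫ x, ‖f x‖ ∂μ := by
          rw [integral_finsetSum _ fun k _ => (hk k).norm]
          simp_rw [hki (fun x => ‖f x‖) hfm.norm]
          simp
  refine ⟨hint, ?_⟩
  rw [integral_prod_symm _ hint]
  have (n : ℕ) : ∫ ω : ℕ → X, ∑ k ∈ Finset.range n, f (ω k)
      ∂(Measure.infinitePi fun _ : ℕ => μ) = n * ∫ x, f x ∂μ := by
    rw [integral_finsetSum _ fun k _ => hk k]
    simp_rw [hki f hfm]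
    simp
  simp_rw [this]
  rw [integral_mul_const, integral_natCast_poissonMeasure]

/-- The exponential moment of a compound Poisson sum. -/
lemma integral_exp_compoundPoisson {X : Type*} [MeasurableSpace X] (μ : Measure X)
    [IsProbabilityMeasure μ] (r : NNReal) (f : X → ℝ) (hfm : Measurable f)
    (hint : Integrable (fun p : (ℕ → X) × ℕ => Real.exp (∑ k ∈ Finset.range p.2, f (p.1 k)))
      ((Measure.infinitePi fun _ : ℕ => μ).prod (poissonMeasure r))) :
    ∫ p : (ℕ → X) × ℕ, Real.exp (∑ k ∈ Finset.range p.2, f (p.1 k))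
      ∂((Measure.infinitePi fun _ : ℕ => μ).prod (poissonMeasure r)) =
      Real.exp (r * (∫ x, Real.exp (f x) ∂μ - 1)) := by
  rw [integral_prod_symm _ hint, ← integral_pow_poissonMeasure]
  refine integral_congr_ae (ae_of_all _ fun n => ?_)
  have h := (iIndepFun_infinitePi (P := fun _ : ℕ => μ) (X := fun _ => f)
    fun _ => hfm).mgf_sum (t := 1) (fun k => hfm.comp (measurable_pi_apply k)) (Finset.range n)
  simp only [mgf, one_mul, Finset.sum_apply] at h
  simp only [h]
  simp only [integral_infinitePi_eval μ hfm.exp]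
  simp

/-- A quadratic bound for the exponential moment of a nonnegative random variable. -/
lemma exp_mul_le_quadratic {α u w : ℝ} (hα : 0 < α) (hu : 0 ≤ u) (huα : u ≤ α / 2) (hw : 0 ≤ w) :
    Real.exp (u * w) ≤ 1 + u * w + u ^ 2 * (8 / α ^ 2) * Real.exp (α * w) := by
  -- This is `(1 - x) * exp x ≤ 1`, used twice.
  have h1 : ∀ x : ℝ, 0 ≤ x → Real.exp x ≤ 1 + x + x ^ 2 * Real.exp x := by
    intro x hx
    have h2 := mul_le_mul_of_nonneg_right (Real.one_sub_le_exp_neg x) (Real.exp_pos x).le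
    have h3 : Real.exp (-x) * Real.exp x = 1 := by rw [← Real.exp_add]; simp
    nlinarith
  have h2 := h1 (u * w) (by positivity)
  -- Half of the exponent `α * w` absorbs `w ^ 2`; the other half absorbs `exp (u * w)`.
  have h3 : w ^ 2 ≤ 8 / α ^ 2 * Real.exp (α * w / 2) := by
    have h4 := Real.quadratic_le_exp_of_nonneg (x := α * w / 2) (by positivity)
    have h5 : (α * w / 2) ^ 2 / 2 ≤ Real.exp (α * w / 2) := by
      have : 0 ≤ α * w / 2 := by positivity
      linarith
    rw [div_mul_eq_mul_div, le_div_iff₀ (by positivity)]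
    linarith
  have h4 : Real.exp (u * w) ≤ Real.exp (α * w / 2) := Real.exp_le_exp.2 (by nlinarith)
  have h5 : Real.exp (α * w) = Real.exp (α * w / 2) * Real.exp (α * w / 2) := by
    rw [← Real.exp_add]; ring_nf
  have h6 : w ^ 2 * Real.exp (u * w) ≤ 8 / α ^ 2 * Real.exp (α * w) := by
    rw [h5, ← mul_assoc]
    exact mul_le_mul h3 h4 (Real.exp_pos _).le (by positivity)
  have h7 := mul_le_mul_of_nonneg_left h6 (sq_nonneg u)
  nlinarith

end General

namespace FluidNetwork

variable {d : ℕ}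

/-! ### The inverse of the reflection matrix dominates the identity on nonnegative vectors. -/

section Routing

lemma R_eq (S : FluidNetwork d) : S.R = 1 - S.Q.transpose := by
  simp [R, Matrix.transpose_sub]

lemma tendsto_transpose_pow_mulVec (S : FluidNetwork d) (x : Fin d → ℝ) (i : Fin d) :
    Tendsto (fun n : ℕ => ((S.Q.transpose ^ n).mulVec x) i) atTop (nhds 0) := by
  have h : Tendsto (fun n : ℕ => ∑ j, (S.Q ^ n) j i * x j) atTop (nhds (∑ j : Fin d, 0 * x j)) :=
    tendsto_finsetSum _ fun j _ => (S.Q_pow_tendsto j i).mul_const _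
  simpa [Matrix.mulVec, dotProduct, ← Matrix.transpose_pow] using h

/-- A kernel vector is fixed by `Qᵀ`, whose powers tend to zero. -/
lemma isUnit_R (S : FluidNetwork d) : IsUnit S.R := by
  rw [← Matrix.mulVec_injective_iff_isUnit]
  intro x y hxy
  have h0 : S.Q.transpose.mulVec (x - y) = x - y := by
    have : S.R.mulVec (x - y) = 0 := by rw [Matrix.mulVec_sub, sub_eq_zero]; exact hxy
    rw [R_eq, Matrix.sub_mulVec, Matrix.one_mulVec, sub_eq_zero] at this
    exact this.symm
  have h1 (n : ℕ) : (S.Q.transpose ^ n).mulVec (x - y) = x - y := by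
    induction n with
    | zero => simp
    | succ n ih => rw [pow_succ, ← Matrix.mulVec_mulVec, h0, ih]
  ext i
  have h2 := S.tendsto_transpose_pow_mulVec (x - y) i
  simp only [h1] at h2
  have h3 := tendsto_nhds_unique h2 tendsto_const_nhds
  exact sub_eq_zero.1 h3.symm

lemma isUnit_det_R (S : FluidNetwork d) : IsUnit S.R.det :=
  (Matrix.isUnit_iff_isUnit_det _).1 S.isUnit_R

lemma inv_R_mulVec_R (S : FluidNetwork d) (x : Fin d → ℝ) :
    S.R⁻¹.mulVec (S.R.mulVec x) = x := by
  rw [Matrix.mulVec_mulVec, Matrix.nonsing_inv_mul _ S.isUnit_det_R, Matrix.one_mulVec]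

/-- The solution satisfies `y = x + Qᵀ y`, so it suffices that `Qᵀ y ≥ 0`. Applying powers of `Qᵀ`
to this identity shows that `(Qᵀ)ⁿ y` decreases in `n ≥ 1`, and its limit is zero. -/
lemma le_inv_R_mulVec (S : FluidNetwork d) {x : Fin d → ℝ} (hx : ∀ i, 0 ≤ x i) (i : Fin d) :
    x i ≤ (S.R⁻¹.mulVec x) i := by
  set y := S.R⁻¹.mulVec x with hy
  have hRy : S.R.mulVec y = x := by
    rw [hy, Matrix.mulVec_mulVec, Matrix.mul_nonsing_inv _ S.isUnit_det_R, Matrix.one_mulVec]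
  have hfix : y = x + S.Q.transpose.mulVec y := by
    rw [R_eq, Matrix.sub_mulVec, Matrix.one_mulVec] at hRy
    rw [← hRy]; simp
  clear_value y
  have hpow (n : ℕ) : ∀ i j, 0 ≤ (S.Q.transpose ^ n) i j := by
    induction n with
    | zero => intro i j; rw [pow_zero, Matrix.one_apply]; split_ifs <;> simp
    | succ n ih =>
      intro i j
      rw [pow_succ, Matrix.mul_apply]
      exact Finset.sum_nonneg fun k _ => mul_nonneg (ih i k) (S.Q_nonneg j k)
  have hstep (n : ℕ) : ((S.Q.transpose ^ (n + 1)).mulVec y) i ≤ (S.Q.transpose.mulVec y) i := by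
    induction n with
    | zero => simp
    | succ n ih =>
      refine le_trans ?_ ih
      conv_rhs => rw [hfix]
      rw [Matrix.mulVec_add, Matrix.mulVec_mulVec, ← pow_succ]
      simp only [Pi.add_apply, le_add_iff_nonneg_left]
      exact Finset.sum_nonneg (s := Finset.univ) fun k _ => mul_nonneg (hpow (n + 1) i k) (hx k)
  have hlim := (tendsto_add_atTop_iff_nat 1).2 (S.tendsto_transpose_pow_mulVec y i)
  have h0 := le_of_tendsto hlim (Eventually.of_forall hstep)
  have h1 := congrFun hfix i
  simp only [Pi.add_apply] at h1
  linarith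

end Routing

/-! ### The drift gap and the Cramér equation for a single job. -/

section Drift

lemma netInput_apply (v : Fin d → ℝ) (t : ℝ) (p : (ℕ → Fin d → ℝ) × ℕ) (i : Fin d) :
    netInput v t p i = ∑ k ∈ Finset.range p.2, p.1 k i - t * v i := by
  simp [netInput]

lemma meanX_eq (S : FluidNetwork d) (i : Fin d) (h : Integrable (fun w => w i) S.jobLaw) :
    S.meanX i = S.rate * ∫ w, w i ∂S.jobLaw - (S.R.mulVec S.r) i := by
  obtain ⟨h1, h2⟩ := integral_compoundPoisson S.jobLaw (S.rate * 1).toNNReal (fun w => w i)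
    (measurable_pi_apply i) h
  have hc : ((S.rate * 1).toNNReal : ℝ) = S.rate := by simp [S.rate_pos.le]
  rw [hc] at h2
  simp only [meanX, netInput_apply, inputLaw, one_mul]
  rw [integral_sub h1 (integrable_const _), h2]
  simp

/-- With `μ = rate * E W`, C1 reads `R⁻¹ μ - r < -δ₀`, and `R⁻¹ μ ≥ μ` settles `v = r`. For the
dominating process the terms `R r` cancel and `v = μ + η`. -/
lemma IsDrift.add_le {S : FluidNetwork d} {δ₀ : ℝ} {v : Fin d → ℝ} (hv : S.IsDrift δ₀ v)
    (hint : ∀ i, Integrable (fun w => w i) S.jobLaw)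
    (hC1 : ∀ i, (S.R⁻¹.mulVec S.meanX) i < -δ₀) (i : Fin d) :
    δ₀ + S.rate * ∫ w, w i ∂S.jobLaw ≤ v i := by
  rcases hv with rfl | ⟨η, hη, -, rfl⟩
  · set μ : Fin d → ℝ := fun i => S.rate * ∫ w, w i ∂S.jobLaw with hμ
    have hm : S.meanX = μ - S.R.mulVec S.r := by
      ext j; rw [S.meanX_eq j (hint j)]; rfl
    have h1 := hC1 i
    rw [hm, Matrix.mulVec_sub, inv_R_mulVec_R] at h1
    have hnn : ∀ j, 0 ≤ μ j := fun j =>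
      mul_nonneg S.rate_pos.le (integral_nonneg_of_ae (S.job_nonneg.mono fun w hw => hw j))
    have h2 := S.le_inv_R_mulVec hnn i
    simp only [Pi.sub_apply] at h1
    change δ₀ + μ i ≤ _
    linarith
  · simp only [Pi.add_apply, S.meanX_eq i (hint i)]
    linarith

lemma IsCramerRoot.rate_mul_eq {S : FluidNetwork d} {v θ : Fin d → ℝ}
    (h : S.IsCramerRoot v θ) (i : Fin d) : S.rate * (S.jobMgf θ i - 1) = θ i * v i := by
  obtain ⟨-, h1, h2⟩ := h i
  have hc : ((S.rate * 1).toNNReal : ℝ) = S.rate := by simp [S.rate_pos.le]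
  have he (p : (ℕ → Fin d → ℝ) × ℕ) : Real.exp (θ i * netInput v 1 p i)
      = Real.exp (-(θ i * v i)) * Real.exp (∑ k ∈ Finset.range p.2, θ i * p.1 k i) := by
    rw [netInput_apply, ← Real.exp_add, ← Finset.mul_sum]; ring_nf
  simp only [he] at h1 h2
  have h3 := (integrable_const_mul_iff (Real.exp_pos _).ne'.isUnit _).1 h1
  rw [integral_const_mul] at h2
  have h4 := integral_exp_compoundPoisson S.jobLaw (S.rate * 1).toNNReal (fun w => θ i * w i)
    (by fun_prop) h3
  rw [hc] at h4
  change ∫ p : (ℕ → Fin d → ℝ) × ℕ, _ ∂(S.inputLaw 1) = _ at h4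
  -- The compound Poisson transform is the exponential of `rate * (φ - 1) - θ i * v i`, so this
  -- exponent is zero.
  rw [h4, ← Real.exp_add, Real.exp_eq_one_iff] at h2
  change -(θ i * v i) + S.rate * (S.jobMgf θ i - 1) = 0 at h2
  linarith

end Drift

end FluidNetwork

/-! ### Uniform bounds on the Cramér roots and on the tilted steps. -/

namespace FluidNetwork

variable {d : ℕ}

/-- Uniform bounds on a network, its drift `v`, its Cramér roots `θ` and the exponential moments of
its jobs that suffice to bound the running time. -/
structure Regular (S : FluidNetwork d) (δ₀ H α ζ : ℝ) (v θ δ : Fin d → ℝ) : Prop where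
  δ₀_pos : 0 < δ₀
  H_pos : 0 < H
  α_pos : 0 < α
  ζ_pos : 0 < ζ
  drift : ∀ i, δ₀ + S.rate * ∫ w, w i ∂S.jobLaw ≤ v i
  root_pos : ∀ i, 0 < θ i
  root : ∀ i, S.rate * (S.jobMgf θ i - 1) = θ i * v i
  integrable : ∀ i, Integrable (fun w => Real.exp (δ i * w i)) S.jobLaw
  integral_le : ∀ i, ∫ w, Real.exp (δ i * w i) ∂S.jobLaw ≤ H
  root_lt : ∀ i, θ i + α < δ i
  rate_le : S.rate ≤ 1 / ζ

/-- A lower bound of the Cramér roots. -/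
def rootBound (δ₀ H α ζ : ℝ) : ℝ := min (α / 2) (δ₀ * ζ * α ^ 2 / (16 * H))

/-- A lower bound of the relative decrease of the exponential moment in each tilted step. -/
def stepGap (δ₀ H α ζ : ℝ) : ℝ := δ₀ * rootBound δ₀ H α ζ * ζ / (2 * H)

lemma integrable_exp_of_le (S : FluidNetwork d) {i : Fin d} {u δ : ℝ} (hu : u ≤ δ)
    (h : Integrable (fun w => Real.exp (δ * w i)) S.jobLaw) :
    Integrable (fun w => Real.exp (u * w i)) S.jobLaw :=
  h.mono' (by fun_prop : Measurable fun w : Fin d → ℝ =>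
    Real.exp (u * w i)).aestronglyMeasurable <| S.job_nonneg.mono fun w hw => by
    rw [Real.norm_of_nonneg (Real.exp_pos _).le]
    exact Real.exp_le_exp.2 (mul_le_mul_of_nonneg_right hu (hw i))

lemma integrable_job (S : FluidNetwork d) {i : Fin d} {δ : ℝ} (hδ : 0 < δ)
    (h : Integrable (fun w => Real.exp (δ * w i)) S.jobLaw) :
    Integrable (fun w => w i) S.jobLaw :=
  (h.const_mul δ⁻¹).mono' (measurable_pi_apply i).aestronglyMeasurable <| S.job_nonneg.mono fun w hw => by
    rw [Real.norm_of_nonneg (hw i), ← div_eq_inv_mul, le_div_iff₀ hδ]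
    linarith [Real.add_one_le_exp (δ * w i)]

namespace Regular

variable {S : FluidNetwork d} {δ₀ H α ζ : ℝ} {v θ δ : Fin d → ℝ}

lemma rootBound_pos (h : S.Regular δ₀ H α ζ v θ δ) : 0 < rootBound δ₀ H α ζ := by
  have := h.δ₀_pos; have := h.H_pos; have := h.α_pos; have := h.ζ_pos
  exact lt_min (by positivity) (by positivity)

lemma stepGap_pos (h : S.Regular δ₀ H α ζ v θ δ) : 0 < stepGap δ₀ H α ζ := by
  have := h.δ₀_pos; have := h.H_pos; have := h.rootBound_pos; have := h.ζ_pos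
  unfold stepGap; positivity

lemma integral_exp_le (h : S.Regular δ₀ H α ζ v θ δ) {i : Fin d} {u : ℝ} (hu : u ≤ δ i) :
    ∫ w, Real.exp (u * w i) ∂S.jobLaw ≤ H :=
  (integral_mono_ae (S.integrable_exp_of_le hu (h.integrable i)) (h.integrable i)
    (S.job_nonneg.mono fun _ hw =>
      Real.exp_le_exp.2 (mul_le_mul_of_nonneg_right hu (hw i)))).trans (h.integral_le i)

lemma α_le (h : S.Regular δ₀ H α ζ v θ δ) (i : Fin d) : α ≤ δ i := by
  linarith [h.root_pos i, h.root_lt i]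

lemma root_le (h : S.Regular δ₀ H α ζ v θ δ) (i : Fin d) : θ i ≤ δ i := by
  linarith [h.α_pos, h.root_lt i]

lemma le_drift (h : S.Regular δ₀ H α ζ v θ δ) (i : Fin d) : δ₀ ≤ v i := by
  have h1 : 0 ≤ S.rate * ∫ w, w i ∂S.jobLaw :=
    mul_nonneg S.rate_pos.le (integral_nonneg_of_ae (S.job_nonneg.mono fun w hw => hw i))
  linarith [h.drift i]

lemma integrable_exp_root (h : S.Regular δ₀ H α ζ v θ δ) (i : Fin d) :
    Integrable (fun w => Real.exp (θ i * w i)) S.jobLaw :=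
  S.integrable_exp_of_le (h.root_le i) (h.integrable i)

lemma jobMgf_le (h : S.Regular δ₀ H α ζ v θ δ) (i : Fin d) : S.jobMgf θ i ≤ H :=
  h.integral_exp_le (h.root_le i)

lemma rate_mul_H_le (h : S.Regular δ₀ H α ζ v θ δ) : S.rate * H ≤ H / ζ := by
  have := mul_le_mul_of_nonneg_right h.rate_le h.H_pos.le
  rwa [one_div_mul_eq_div] at this

lemma rate_mul_jobMgf (h : S.Regular δ₀ H α ζ v θ δ) (i : Fin d) :
    S.rate * S.jobMgf θ i = S.rate + θ i * v i := by
  linarith [h.root i]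

lemma add_root_mul_drift_le (h : S.Regular δ₀ H α ζ v θ δ) (i : Fin d) :
    S.rate + θ i * v i ≤ H / ζ := by
  rw [← h.rate_mul_jobMgf i]
  exact (mul_le_mul_of_nonneg_left (h.jobMgf_le i) S.rate_pos.le).trans h.rate_mul_H_le

/-- To first order in `u` the drift gap wins `u * δ₀`; for `u` up to `rootBound` the second-order
error costs at most half of it. -/
lemma laplace_le (h : S.Regular δ₀ H α ζ v θ δ) (i : Fin d) {u : ℝ} (hu : 0 ≤ u)
    (hu' : u ≤ rootBound δ₀ H α ζ) :
    S.rate * ∫ w, Real.exp (u * w i) ∂S.jobLaw ≤ S.rate + u * v i - u * δ₀ / 2 := by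
  have hα := h.α_pos; have hH := h.H_pos; have hζ := h.ζ_pos; have hδ := h.δ₀_pos
  have hu1 : u ≤ α / 2 := hu'.trans (min_le_left _ _)
  have hu2 : u ≤ δ₀ * ζ * α ^ 2 / (16 * H) := hu'.trans (min_le_right _ _)
  have hint := S.integrable_job (h.α_pos.trans_le (h.α_le i)) (h.integrable i)
  have hexp := S.integrable_exp_of_le (h.α_le i) (h.integrable i)
  have h1 : ∫ w, Real.exp (u * w i) ∂S.jobLaw ≤
      ∫ w, (1 + u * w i + u ^ 2 * (8 / α ^ 2) * Real.exp (α * w i)) ∂S.jobLaw :=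
    integral_mono_ae (S.integrable_exp_of_le (by linarith [h.α_le i]) (h.integrable i))
      (((integrable_const _).add (hint.const_mul u)).add (hexp.const_mul _))
      (S.job_nonneg.mono fun w hw => exp_mul_le_quadratic hα hu hu1 (hw i))
  have h0 : ∫ w, (1 + u * w i + u ^ 2 * (8 / α ^ 2) * Real.exp (α * w i)) ∂S.jobLaw =
      1 + u * ∫ w, w i ∂S.jobLaw +
        u ^ 2 * (8 / α ^ 2) * ∫ w, Real.exp (α * w i) ∂S.jobLaw := by
    have ha : Integrable (fun w : Fin d → ℝ => 1 + u * w i) S.jobLaw :=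
      (integrable_const _).add (hint.const_mul u)
    rw [integral_add ha (hexp.const_mul _), integral_add (integrable_const _) (hint.const_mul u),
      integral_const_mul, integral_const_mul]
    simp
  rw [h0] at h1
  have h2 : ∫ w, Real.exp (α * w i) ∂S.jobLaw ≤ H := h.integral_exp_le (h.α_le i)
  -- The second entry of the minimum in `rootBound` is chosen for this inequality, the first for
  -- `exp_mul_le_quadratic`.
  have h3 : u * (8 / α ^ 2) * (H / ζ) ≤ δ₀ / 2 := by
    calc u * (8 / α ^ 2) * (H / ζ)
        ≤ δ₀ * ζ * α ^ 2 / (16 * H) * (8 / α ^ 2) * (H / ζ) := by gcongr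
      _ = δ₀ / 2 := by field_simp; norm_num
  have h4 : S.rate * (u ^ 2 * (8 / α ^ 2) * ∫ w, Real.exp (α * w i) ∂S.jobLaw) ≤ u * δ₀ / 2 := by
    calc S.rate * (u ^ 2 * (8 / α ^ 2) * ∫ w, Real.exp (α * w i) ∂S.jobLaw)
        ≤ S.rate * (u ^ 2 * (8 / α ^ 2) * H) := by
          have := S.rate_pos; gcongr
      _ = u * (u * (8 / α ^ 2) * (S.rate * H)) := by ring
      _ ≤ u * (u * (8 / α ^ 2) * (H / ζ)) := by
          have := h.rate_mul_H_le; gcongr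
      _ ≤ u * (δ₀ / 2) := by gcongr
      _ = u * δ₀ / 2 := by ring
  have h5 := mul_le_mul_of_nonneg_left h1 S.rate_pos.le
  have h6 := mul_le_mul_of_nonneg_left (h.drift i) hu
  nlinarith

/-- At the root `laplace_le` would hold with equality and no loss `θ i * δ₀ / 2`, so the root lies
outside its range. -/
lemma rootBound_lt (h : S.Regular δ₀ H α ζ v θ δ) (i : Fin d) : rootBound δ₀ H α ζ < θ i := by
  by_contra! hle
  have h1 := h.laplace_le i (h.root_pos i).le hle
  change S.rate * S.jobMgf θ i ≤ _ at h1
  rw [h.rate_mul_jobMgf] at h1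
  linarith [mul_pos (h.root_pos i) h.δ₀_pos]

/-- The Cramér equation bounds `θ i * v i` by `rate * H`, and `v i ≥ δ₀`. -/
lemma root_le_const (h : S.Regular δ₀ H α ζ v θ δ) (i : Fin d) : θ i ≤ H / (ζ * δ₀) := by
  have h1 := h.add_root_mul_drift_le i
  have h2 := mul_le_mul_of_nonneg_left (h.le_drift i) (h.root_pos i).le
  rw [← div_div, le_div_iff₀ h.δ₀_pos]
  linarith [S.rate_pos]

/-- Makes the loss in `laplace_le` relative: the main term is at most `H / ζ`, which explains the
form of `stepGap`. -/
lemma laplace_rootBound_le (h : S.Regular δ₀ H α ζ v θ δ) (i : Fin d) :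
    S.rate * ∫ w, Real.exp (rootBound δ₀ H α ζ * w i) ∂S.jobLaw ≤
      (1 - stepGap δ₀ H α ζ) * (S.rate + rootBound δ₀ H α ζ * v i) := by
  have h1 := h.laplace_le i h.rootBound_pos.le le_rfl
  have h2 : S.rate + rootBound δ₀ H α ζ * v i ≤ H / ζ :=
    le_trans (by gcongr; exacts [h.δ₀_pos.le.trans (h.le_drift i), (h.rootBound_lt i).le])
      (h.add_root_mul_drift_le i)
  have h3 := mul_le_mul_of_nonneg_left h2 h.stepGap_pos.le
  have h4 : stepGap δ₀ H α ζ * (H / ζ) = rootBound δ₀ H α ζ * δ₀ / 2 := by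
    have := h.H_pos; have := h.ζ_pos
    unfold stepGap; field_simp
  linarith

/-- The tilt by `θ k` and the exponent `-(θ k - u)` combine to the untilted transform at `u =
rootBound`; the Cramér equation turns the exponential factor into one with denominator `rate + u * v
k`. -/
lemma lintegral_exp_tiltedPairLaw_le (h : S.Regular δ₀ H α ζ v θ δ) (k : Fin d) :
    ∫⁻ p, ENNReal.ofReal (Real.exp (-((θ k - rootBound δ₀ H α ζ) * (p.1 k - p.2 * v k))))
      ∂(S.tiltedPairLaw θ k) ≤ ENNReal.ofReal (1 - stepGap δ₀ H α ζ) := by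
  have hφ := S.jobMgf_pos θ k (h.integrable_exp_root k)
  have hr : 0 < S.rate * S.jobMgf θ k := mul_pos S.rate_pos hφ
  have := isProbabilityMeasure_tilted (h.integrable_exp_root k)
  have := isProbabilityMeasure_expMeasure hr
  have hv : 0 < v k := h.δ₀_pos.trans_le (h.le_drift k)
  set u := rootBound δ₀ H α ζ with hu
  have hu0 : 0 < u := h.rootBound_pos
  have hden : 0 < S.rate + u * v k := add_pos S.rate_pos (mul_pos hu0 hv)
  have hsplit (p : (Fin d → ℝ) × ℝ) :
      ENNReal.ofReal (Real.exp (-((θ k - u) * (p.1 k - p.2 * v k)))) =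
      ENNReal.ofReal (Real.exp (-((θ k - u) * p.1 k))) *
        ENNReal.ofReal (Real.exp ((θ k - u) * v k * p.2)) := by
    rw [← ENNReal.ofReal_mul (Real.exp_pos _).le, ← Real.exp_add]; ring_nf
  simp_rw [hsplit]
  rw [tiltedPairLaw, lintegral_prod_mul (f := fun w : Fin d → ℝ =>
      ENNReal.ofReal (Real.exp (-((θ k - u) * w k))))
      (g := fun t => ENNReal.ofReal (Real.exp ((θ k - u) * v k * t)))
      (Measurable.aemeasurable (by fun_prop)) (Measurable.aemeasurable (by fun_prop)),
    lintegral_exp_mul_expMeasure hr (by rw [h.rate_mul_jobMgf]; nlinarith [S.rate_pos]),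
    lintegral_tilted]
  have h1 (w : Fin d → ℝ) : ENNReal.ofReal (Real.exp (θ k * w k) /
        ∫ w, Real.exp (θ k * w k) ∂S.jobLaw) * ENNReal.ofReal (Real.exp (-((θ k - u) * w k))) =
      ENNReal.ofReal (Real.exp (u * w k) / S.jobMgf θ k) := by
    change ENNReal.ofReal (_ / S.jobMgf θ k) * _ = _
    rw [← ENNReal.ofReal_mul (by positivity), div_mul_eq_mul_div, ← Real.exp_add]
    ring_nf
  simp_rw [h1]
  have hui : Integrable (fun w => Real.exp (u * w k)) S.jobLaw :=
    S.integrable_exp_of_le ((h.rootBound_lt k).le.trans (h.root_le k)) (h.integrable k)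
  rw [← ofReal_integral_eq_lintegral_ofReal (hui.div_const _)
      (ae_of_all _ fun w => by positivity), integral_div,
    ← ENNReal.ofReal_mul (div_nonneg (integral_nonneg fun w => (Real.exp_pos _).le) hφ.le)]
  refine ENNReal.ofReal_le_ofReal ?_
  have h2 : S.rate * S.jobMgf θ k - (θ k - u) * v k = S.rate + u * v k := by
    rw [h.rate_mul_jobMgf]; ring
  rw [h2]
  have h3 := h.laplace_rootBound_le k
  calc (∫ w, Real.exp (u * w k) ∂S.jobLaw) / S.jobMgf θ k *
        (S.rate * S.jobMgf θ k / (S.rate + u * v k))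
      = S.rate * (∫ w, Real.exp (u * w k) ∂S.jobLaw) / (S.rate + u * v k) := by
        field_simp
    _ ≤ 1 - stepGap δ₀ H α ζ := by rwa [div_le_iff₀ hden]

/-- Ensures that `ENNReal.ofReal (1 - stepGap)` does not truncate when the geometric series is
summed. -/
lemma stepGap_le_one (h : S.Regular δ₀ H α ζ v θ δ) (k : Fin d) : stepGap δ₀ H α ζ ≤ 1 := by
  have h1 := h.laplace_rootBound_le k
  have h2 : 0 < S.rate + rootBound δ₀ H α ζ * v k :=
    add_pos S.rate_pos (mul_pos h.rootBound_pos (h.δ₀_pos.trans_le (h.le_drift k)))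
  have h3 : 0 ≤ S.rate * ∫ w, Real.exp (rootBound δ₀ H α ζ * w k) ∂S.jobLaw :=
    mul_nonneg S.rate_pos.le (integral_nonneg fun w => (Real.exp_pos _).le)
  by_contra! hlt
  nlinarith

end Regular

/-- The walk driven by a sequence of pairs of job requirements and inter-arrival times. -/
def pairWalk (v : Fin d → ℝ) (ω : ℕ → (Fin d → ℝ) × ℝ) (n : ℕ) : Fin d → ℝ :=
  ∑ j ∈ Finset.range n, ((ω j).1 - (ω j).2 • v)

lemma pairWalk_apply (v : Fin d → ℝ) (ω : ℕ → (Fin d → ℝ) × ℝ) (n : ℕ) (i : Fin d) :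
    pairWalk v ω n i = ∑ j ∈ Finset.range n, ((ω j).1 i - (ω j).2 * v i) := by
  simp [pairWalk]

@[fun_prop]
lemma measurable_pairWalk (v : Fin d → ℝ) (n : ℕ) (i : Fin d) :
    Measurable fun ω => pairWalk v ω n i := by
  simp_rw [pairWalk_apply]
  fun_prop

/-- The sequences whose walk is at most `m` in all coordinates after `n` steps. -/
def belowSet (v : Fin d → ℝ) (m : ℝ) (n : ℕ) : Set (ℕ → (Fin d → ℝ) × ℝ) :=
  {ω | ∀ i, pairWalk v ω n i ≤ m}

lemma measurableSet_belowSet (v : Fin d → ℝ) (m : ℝ) (n : ℕ) :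
    MeasurableSet (belowSet v m n) := by
  simp only [belowSet, Set.ofPred_forall]
  exact MeasurableSet.iInter fun i => measurableSet_le (by fun_prop) measurable_const

/-- The number of steps after which the walk is at most `m` in all coordinates. -/
def belowCount (v : Fin d → ℝ) (m : ℝ) (ω : ℕ → (Fin d → ℝ) × ℝ) : ENNReal :=
  ∑' n, (belowSet v m n).indicator 1 ω

lemma measurable_belowCount (v : Fin d → ℝ) (m : ℝ) : Measurable (belowCount v m) :=
  Measurable.tsum fun n => measurable_one.indicator (measurableSet_belowSet v m n)

/-! ### Expected time of the proposal walk below the level. -/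

namespace Regular

variable {S : FluidNetwork d} {δ₀ H α ζ : ℝ} {v θ δ : Fin d → ℝ}

/-- Chernoff bound for the tilted coordinate `k` alone. -/
lemma measure_belowSet_le (h : S.Regular δ₀ H α ζ v θ δ) (k : Fin d) (m : ℝ) (n : ℕ) :
    (Measure.infinitePi fun _ : ℕ => S.tiltedPairLaw θ k) (belowSet v m n) ≤
      ENNReal.ofReal (Real.exp ((θ k - rootBound δ₀ H α ζ) * m)) *
        ENNReal.ofReal (1 - stepGap δ₀ H α ζ) ^ n := by
  have := S.isProbabilityMeasure_tiltedPairLaw θ k (h.integrable_exp_root k)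
  set s := θ k - rootBound δ₀ H α ζ with hs
  have hs0 : 0 < s := sub_pos.2 (h.rootBound_lt k)
  set f : (Fin d → ℝ) × ℝ → ENNReal :=
    fun p => ENNReal.ofReal (Real.exp (-(s * (p.1 k - p.2 * v k)))) with hf
  have hfm : Measurable f := by fun_prop
  calc (Measure.infinitePi fun _ : ℕ => S.tiltedPairLaw θ k) (belowSet v m n)
      ≤ ∫⁻ ω, ENNReal.ofReal (Real.exp (s * m)) * ∏ j ∈ Finset.range n, f (ω j)
          ∂(Measure.infinitePi fun _ : ℕ => S.tiltedPairLaw θ k) := by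
        refine meas_le_lintegral₀ (Measurable.aemeasurable (by fun_prop)) fun ω hω => ?_
        rw [hf, ← ENNReal.ofReal_prod_of_nonneg fun _ _ => (Real.exp_pos _).le, ← Real.exp_sum,
          ← ENNReal.ofReal_mul (Real.exp_pos _).le, ← Real.exp_add, Finset.sum_neg_distrib,
          ← Finset.mul_sum, ← pairWalk_apply, ENNReal.one_le_ofReal, Real.one_le_exp_iff]
        have := mul_le_mul_of_nonneg_left (hω k) hs0.le
        linarith
    _ = ENNReal.ofReal (Real.exp (s * m)) * (∫⁻ p, f p ∂(S.tiltedPairLaw θ k)) ^ n := by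
        rw [lintegral_const_mul' _ _ ENNReal.ofReal_ne_top,
          lintegral_infinitePi_prod_range _ (fun _ => f) fun _ => hfm]
        simp
    _ ≤ _ := by
        gcongr
        exact h.lintegral_exp_tiltedPairLaw_le k

lemma lintegral_belowCount_le (h : S.Regular δ₀ H α ζ v θ δ) (k : Fin d) {m : ℝ} (hm : 0 ≤ m) :
    ∫⁻ ω, belowCount v m ω ∂(Measure.infinitePi fun _ : ℕ => S.tiltedPairLaw θ k) ≤
      ENNReal.ofReal (Real.exp (H / (ζ * δ₀) * m) / stepGap δ₀ H α ζ) := by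
  simp only [belowCount]
  rw [lintegral_tsum fun n =>
    (measurable_one.indicator (measurableSet_belowSet v m n)).aemeasurable]
  simp_rw [lintegral_indicator_one (measurableSet_belowSet v m _)]
  refine (ENNReal.tsum_le_tsum fun n => h.measure_belowSet_le k m n).trans ?_
  rw [ENNReal.tsum_mul_left, ENNReal.tsum_geometric, ← ENNReal.ofReal_one,
    ← ENNReal.ofReal_sub _ (sub_nonneg.2 (h.stepGap_le_one k)), sub_sub_cancel,
    ← ENNReal.ofReal_inv_of_pos h.stepGap_pos, ← ENNReal.ofReal_mul (Real.exp_pos _).le,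
    ← div_eq_mul_inv]
  have := h.stepGap_pos
  refine ENNReal.ofReal_le_ofReal ?_
  gcongr
  -- The exponent `θ k - rootBound` is replaced by a constant independent of `k` and `d`.
  linarith [h.root_le_const k, h.rootBound_pos]

lemma lintegral_belowCount_proposalLaw_le [NeZero d] (h : S.Regular δ₀ H α ζ v θ δ) {m : ℝ}
    (hm : 0 ≤ m) :
    ∫⁻ p, belowCount v m p.2 ∂(S.proposalLaw θ) ≤
      ENNReal.ofReal (Real.exp (H / (ζ * δ₀) * m) / stepGap δ₀ H α ζ) := by
  have := fun k => S.isProbabilityMeasure_tiltedPairLaw θ k (h.integrable_exp_root k)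
  have hk (k : Fin d) : ∫⁻ p, belowCount v m p.2
      ∂((Measure.dirac k).prod (Measure.infinitePi fun _ : ℕ => S.tiltedPairLaw θ k)) ≤
      ENNReal.ofReal (Real.exp (H / (ζ * δ₀) * m) / stepGap δ₀ H α ζ) := by
    have hmeas : Measurable fun p : Fin d × (ℕ → (Fin d → ℝ) × ℝ) => belowCount v m p.2 :=
      (measurable_belowCount v m).comp measurable_snd
    rw [lintegral_prod _ hmeas.aemeasurable, lintegral_dirac]
    exact h.lintegral_belowCount_le k hm
  rw [proposalLaw, lintegral_finsetSum_measure]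
  simp_rw [lintegral_smul_measure, smul_eq_mul]
  refine (Finset.sum_le_sum fun k _ => mul_le_mul_right (hk k) _).trans ?_
  rw [← Finset.sum_mul, ← ENNReal.ofReal_sum_of_nonneg fun k _ => weight_nonneg θ k, sum_weight]
  simp

end Regular

end FluidNetwork

namespace FluidNetwork

variable {d : ℕ}

/-! ### Halting and cost of one pass, and the geometric series over passes. -/

section Pass

variable {v θ : Fin d → ℝ}

/-- All times before the crossing, including time 0, are spent below the level. This replaces the
first passage time by a sum of events at fixed times. -/
lemma crossing_le_belowCount (v θ : Fin d → ℝ) (x : Draw d) :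
    (crossing v θ x : ENNReal) ≤ belowCount v (level θ) x.pairs := by
  classical
  have key : ∀ N : ℕ, (∀ n < N, ¬ ∃ i, level θ < walk v x n i) →
      (N : ENNReal) ≤ belowCount v (level θ) x.pairs := by
    intro N hN
    refine le_trans (le_of_eq ?_) (ENNReal.sum_le_tsum (Finset.range N))
    rw [Finset.sum_congr rfl fun n hn => Set.indicator_of_mem (s := belowSet v (level θ) n)
      (f := 1) (a := x.pairs) ?_]
    · simp
    · have := hN n (Finset.mem_range.1 hn)
      push Not at this
      exact this
  unfold crossing
  split_ifs with h
  · simpa using key (Nat.find h) fun n hn => Nat.find_min h hn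
  · push Not at h
    rw [ENat.toENNReal_top, top_le_iff]
    refine ENNReal.eq_top_of_forall_nnreal_le fun r => ?_
    obtain ⟨N, hN⟩ := exists_nat_ge r
    refine le_trans ?_ (key N fun n _ => by simpa using h n)
    exact_mod_cast hN

/-- Finiteness excludes `crossing = ⊤`, where `toNat` would give the meaningless time 0. -/
lemma exists_level_lt_walk_crossing {x : Draw d}
    (h : belowCount v (level θ) x.pairs < ⊤) :
    ∃ i, level θ < walk v x (crossing v θ x).toNat i := by
  classical
  have h1 := (crossing_le_belowCount v θ x).trans_lt h
  unfold crossing at h1 ⊢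
  split_ifs at h1 ⊢ with h2
  · simpa using Nat.find_spec h2
  · simp at h1

/-- The level makes the normalizer `∑ exp (-θ j * m)` at most `d * d⁻² = 1 / d`. In the coordinate
`i` that exceeds `m`, the factor `exp (θ i * C i)` cancels the numerator of the weight, so this term
alone is at least `d`. -/
lemma acceptProb_le [NeZero d] {x : Draw d} (hθ : ∀ i, 0 < θ i)
    (hlevel : ∀ i, 2 * Real.log d ≤ θ i * level θ)
    (h : belowCount v (level θ) x.pairs < ⊤) : acceptProb v θ x ≤ 1 / d := by
  obtain ⟨i, hi⟩ := exists_level_lt_walk_crossing h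
  have hd : (0 : ℝ) < d := by exact_mod_cast Nat.pos_of_ne_zero (NeZero.ne d)
  set C := walk v x (crossing v θ x).toNat with hC
  have hpos : 0 < ∑ j : Fin d, Real.exp (-(θ j * level θ)) :=
    Finset.sum_pos (fun _ _ => Real.exp_pos _) ⟨0, Finset.mem_univ _⟩
  have hsum : ∑ j : Fin d, Real.exp (-(θ j * level θ)) ≤ 1 / d := by
    calc ∑ j : Fin d, Real.exp (-(θ j * level θ))
        ≤ ∑ _j : Fin d, ((d : ℝ) * d)⁻¹ := by
          refine Finset.sum_le_sum fun j _ => ?_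
          have : Real.exp (-(2 * Real.log d)) = ((d : ℝ) * d)⁻¹ := by
            rw [Real.exp_neg, two_mul, Real.exp_add, Real.exp_log hd]
          rw [← this]
          exact Real.exp_le_exp.2 (neg_le_neg (hlevel j))
      _ = 1 / d := by simp; field_simp
  have h1 : (d : ℝ) ≤ ∑ k, weight θ k * Real.exp (θ k * C k) := by
    calc (d : ℝ) ≤ 1 / ∑ j : Fin d, Real.exp (-(θ j * level θ)) := by
          rw [le_div_iff₀ hpos]
          calc (d : ℝ) * _ ≤ d * (1 / d) := by gcongr
            _ = 1 := by field_simp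
      _ = weight θ i * Real.exp (θ i * level θ) := by
          rw [weight, div_mul_eq_mul_div, ← Real.exp_add]; simp
      _ ≤ weight θ i * Real.exp (θ i * C i) := by
          have := weight_nonneg θ i
          have := (hθ i).le
          gcongr
      _ ≤ _ := Finset.single_le_sum (f := fun k => weight θ k * Real.exp (θ k * C k))
          (fun k _ => mul_nonneg (weight_nonneg θ k) (Real.exp_pos _).le) (Finset.mem_univ i)
  exact one_div_le_one_div_of_le hd h1

lemma isProbabilityMeasure_proposalLaw [NeZero d] (S : FluidNetwork d) (θ : Fin d → ℝ)
    (h : ∀ k, Integrable (fun w => Real.exp (θ k * w k)) S.jobLaw) :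
    IsProbabilityMeasure (S.proposalLaw θ) := by
  have h1 := fun k => S.isProbabilityMeasure_tiltedPairLaw θ k (h k)
  constructor
  unfold proposalLaw
  simp only [Measure.finsetSum_apply, Measure.smul_apply, measure_univ, smul_eq_mul, mul_one]
  rw [← ENNReal.ofReal_sum_of_nonneg fun k _ => weight_nonneg θ k, sum_weight]
  simp

/-- Draws that make the algorithm stop. -/
def haltSet (v θ : Fin d → ℝ) (B T : ℝ) : Set (DrawSpace d) :=
  ({w | ∀ i, w i ≤ B} ×ˢ Set.Ioi T) ×ˢ
    ({p | belowCount v (level θ) p.2 < ⊤} ×ˢ Set.Ioi (1 / (d : ℝ)))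

lemma measurableSet_haltSet (v θ : Fin d → ℝ) (B T : ℝ) : MeasurableSet (haltSet v θ B T) := by
  refine MeasurableSet.prod (MeasurableSet.prod ?_ measurableSet_Ioi)
    (MeasurableSet.prod ?_ measurableSet_Ioi)
  · simp only [Set.ofPred_forall]
    exact MeasurableSet.iInter fun i => measurableSet_le (measurable_pi_apply i) measurable_const
  · exact measurableSet_lt ((measurable_belowCount v _).comp measurable_snd) measurable_const

lemma halted_pass_of_halted {x : Draw d} {s : State d} (hs : s.halted = true) :
    pass v θ x s = s := by
  simp [pass, hs]

lemma halted_pass_of_mem_haltSet [NeZero d] {B T : ℝ} (hθ : ∀ i, 0 < θ i) (hv : ∀ i, 0 < v i)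
    (hlevel : ∀ i, 2 * Real.log d ≤ θ i * level θ) (hT : ∀ i, B + level θ ≤ T * v i)
    {x : DrawSpace d} (hx : x ∈ haltSet v θ B T) (s : State d) :
    (pass v θ x.toDraw s).halted = true := by
  obtain ⟨⟨hW, hU⟩, hg, hV⟩ := hx
  have h1 : ¬ ∃ i, -level θ ≤ x.toDraw.W i - x.toDraw.U * v i := by
    rintro ⟨i, hi⟩
    have h2 : x.toDraw.W i ≤ B := hW i
    have h3 : T * v i < x.toDraw.U * v i := mul_lt_mul_of_pos_right hU (hv i)
    linarith [hT i]
  have h2 : ¬ x.toDraw.V ≤ acceptProb v θ x.toDraw :=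
    not_le.2 ((acceptProb_le hθ hlevel (x := x.toDraw) hg).trans_lt hV)
  unfold pass
  split_ifs with hs
  · exact hs
  · rfl

lemma count_pass_le (x : Draw d) (s : State d) :
    (pass v θ x s).count ≤ s.count + 1 + crossing v θ x := by
  unfold pass
  split_ifs
  · rw [add_assoc]; exact le_self_add
  · exact le_self_add
  · exact le_rfl
  · exact le_rfl

/-- A pathwise bound for the cost of the pass number `j`. -/
def passBound (v θ : Fin d → ℝ) (B T : ℝ) (ω : ℕ → DrawSpace d) (j : ℕ) : ENNReal :=
  (∏ i ∈ Finset.range j, (haltSet v θ B T)ᶜ.indicator 1 (ω i)) *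
    (1 + belowCount v (level θ) (ω j).2.1.2)

lemma not_mem_haltSet_of_not_halted [NeZero d] {B T : ℝ} (hθ : ∀ i, 0 < θ i)
    (hv : ∀ i, 0 < v i) (hlevel : ∀ i, 2 * Real.log d ≤ θ i * level θ)
    (hT : ∀ i, B + level θ ≤ T * v i) (ω : ℕ → DrawSpace d) (n : ℕ)
    (hn : ¬ (run v θ ω n).halted = true) : ∀ j < n, ω j ∉ haltSet v θ B T := by
  induction n with
  | zero => simp
  | succ n ih =>
    intro j hj hmem
    rcases Nat.lt_succ_iff_lt_or_eq.1 hj with h | rfl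
    · refine ih (fun hh => hn ?_) j h hmem
      rw [run, halted_pass_of_halted hh, hh]
    · exact hn (halted_pass_of_mem_haltSet hθ hv hlevel hT hmem _)

lemma count_run_le [NeZero d] {B T : ℝ} (hθ : ∀ i, 0 < θ i)
    (hv : ∀ i, 0 < v i) (hlevel : ∀ i, 2 * Real.log d ≤ θ i * level θ)
    (hT : ∀ i, B + level θ ≤ T * v i) (ω : ℕ → DrawSpace d) (n : ℕ) :
    ((run v θ ω n).count : ENNReal) ≤ ∑ j ∈ Finset.range n, passBound v θ B T ω j := by
  induction n with
  | zero => simp [run, State.init]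
  | succ n ih =>
    rw [Finset.sum_range_succ]
    by_cases hs : (run v θ ω n).halted = true
    · rw [run, halted_pass_of_halted hs]
      exact ih.trans le_self_add
    · have h1 := not_mem_haltSet_of_not_halted hθ hv hlevel hT ω n hs
      have h2 : ∏ i ∈ Finset.range n, (haltSet v θ B T)ᶜ.indicator (1 : DrawSpace d → ENNReal) (ω i) = 1 :=
        Finset.prod_eq_one fun i hi => Set.indicator_of_mem (h1 i (Finset.mem_range.1 hi)) _
      have h3 := ENat.toENNReal_le.2 (count_pass_le (v := v) (θ := θ) (ω n).toDraw (run v θ ω n))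
      rw [run]
      refine h3.trans ?_
      rw [passBound, h2, one_mul, ENat.toENNReal_add, ENat.toENNReal_add, add_assoc]
      gcongr
      · simp
      · exact crossing_le_belowCount v θ (ω n).toDraw

lemma totalCount_le [NeZero d] {B T : ℝ} (hθ : ∀ i, 0 < θ i)
    (hv : ∀ i, 0 < v i) (hlevel : ∀ i, 2 * Real.log d ≤ θ i * level θ)
    (hT : ∀ i, B + level θ ≤ T * v i) (ω : ℕ → DrawSpace d) :
    (totalCount v θ ω : ENNReal) ≤ ∑' j, passBound v θ B T ω j := by
  rw [totalCount, ENat.toENNReal_iSup]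
  exact iSup_le fun n => (count_run_le hθ hv hlevel hT ω n).trans (ENNReal.sum_le_tsum _)

lemma measurable_one_add_belowCount (v : Fin d → ℝ) (m : ℝ) :
    Measurable fun x : DrawSpace d => 1 + belowCount v m x.2.1.2 :=
  measurable_const.add ((measurable_belowCount v m).comp (by fun_prop))

/-- The number of passes is geometric. -/
lemma expectedCount_le [NeZero d] (S : FluidNetwork d) {B T : ℝ} (hθ : ∀ i, 0 < θ i)
    (hv : ∀ i, 0 < v i) (hlevel : ∀ i, 2 * Real.log d ≤ θ i * level θ)
    (hT : ∀ i, B + level θ ≤ T * v i)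
    (hint : ∀ k, Integrable (fun w => Real.exp (θ k * w k)) S.jobLaw) :
    S.expectedCount v θ ≤ (S.drawLaw θ (haltSet v θ B T))⁻¹ *
      ∫⁻ x, (1 + belowCount v (level θ) x.2.1.2) ∂(S.drawLaw θ) := by
  have := S.isProbabilityMeasure_drawLaw θ hint
  have hA := measurableSet_haltSet v θ B T
  have hind : Measurable ((haltSet v θ B T)ᶜ.indicator (1 : DrawSpace d → ENNReal)) :=
    measurable_one.indicator hA.compl
  have hg := measurable_one_add_belowCount v (level θ)
  have hterm (j : ℕ) : ∫⁻ ω, passBound v θ B T ω j ∂(S.drawsLaw θ) =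
      (S.drawLaw θ (haltSet v θ B T)ᶜ) ^ j *
        ∫⁻ x, (1 + belowCount v (level θ) x.2.1.2) ∂(S.drawLaw θ) := by
    -- Pass `j` is reached only if the `j` earlier draws miss `haltSet`; these are independent of
    -- its own cost, the factor with index `j`.
    have h := lintegral_infinitePi_prod_range (S.drawLaw θ)
      (fun i => if i < j then (haltSet v θ B T)ᶜ.indicator 1
        else fun x => 1 + belowCount v (level θ) x.2.1.2)
      (fun i => by split_ifs; exacts [hind, hg]) (j + 1)
    rw [Finset.prod_range_succ, Finset.prod_congr rfl fun i hi => by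
      rw [if_pos (Finset.mem_range.1 hi), lintegral_indicator_one hA.compl]] at h
    simp only [lt_irrefl, if_false, Finset.prod_const, Finset.card_range] at h
    rw [← h, drawsLaw]
    refine lintegral_congr fun ω => ?_
    rw [passBound, Finset.prod_range_succ, if_neg (lt_irrefl j)]
    congr 1
    exact Finset.prod_congr rfl fun i hi => by rw [if_pos (Finset.mem_range.1 hi)]
  have hmeas (j : ℕ) : Measurable fun ω => passBound v θ B T ω j := by
    unfold passBound
    exact (Finset.measurable_fun_prod _ fun i _ => hind.comp (measurable_pi_apply i)).mul
      (hg.comp (measurable_pi_apply j))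
  -- Monotonicity of the lower integral needs no measurability of the count itself.
  calc S.expectedCount v θ ≤ ∫⁻ ω, ∑' j, passBound v θ B T ω j ∂(S.drawsLaw θ) :=
        lintegral_mono fun ω => totalCount_le hθ hv hlevel hT ω
    _ = _ := by
        rw [lintegral_tsum fun j => (hmeas j).aemeasurable]
        simp_rw [hterm]
        rw [ENNReal.tsum_mul_right, ENNReal.tsum_geometric, prob_compl_eq_one_sub hA,
          ENNReal.sub_sub_cancel ENNReal.one_ne_top prob_le_one]

end Pass

/-! ### Polynomial bounds in the number of stations. -/

namespace Regular

variable {S : FluidNetwork d} {δ₀ H α ζ : ℝ} {v θ δ : Fin d → ℝ}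

lemma one_le_H [NeZero d] (h : S.Regular δ₀ H α ζ v θ δ) : 1 ≤ H := by
  refine le_trans ?_ (h.integral_exp_le (i := 0) (u := 0) (h.α_pos.le.trans (h.α_le 0)))
  simp

lemma le_ciInf_root [NeZero d] (h : S.Regular δ₀ H α ζ v θ δ) :
    rootBound δ₀ H α ζ ≤ ⨅ i, θ i :=
  le_ciInf fun i => (h.rootBound_lt i).le

lemma level_nonneg [NeZero d] (h : S.Regular δ₀ H α ζ v θ δ) : 0 ≤ level θ :=
  div_nonneg (by have := Real.log_natCast_nonneg d; positivity)
    (h.rootBound_pos.le.trans h.le_ciInf_root)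

lemma level_le [NeZero d] (h : S.Regular δ₀ H α ζ v θ δ) :
    level θ ≤ 2 * Real.log d / rootBound δ₀ H α ζ :=
  div_le_div_of_nonneg_left (by have := Real.log_natCast_nonneg d; positivity)
    h.rootBound_pos h.le_ciInf_root

lemma le_root_mul_level [NeZero d] (h : S.Regular δ₀ H α ζ v θ δ) (i : Fin d) :
    2 * Real.log d ≤ θ i * level θ := by
  have hpos : 0 < ⨅ i, θ i := h.rootBound_pos.trans_le h.le_ciInf_root
  have h1 : ⨅ i, θ i ≤ θ i := ciInf_le (Set.finite_range θ).bddBelow i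
  calc 2 * Real.log d = (⨅ i, θ i) * level θ := by unfold level; field_simp
    _ ≤ θ i * level θ := mul_le_mul_of_nonneg_right h1 h.level_nonneg

/-- The threshold `B` solves `exp (α * B) = 2 * H * d`, so Markov gives each coordinate an
exceedance probability of at most `1 / (2 * d)`. -/
lemma half_le_measure_job_le [NeZero d] (h : S.Regular δ₀ H α ζ v θ δ) :
    ENNReal.ofReal (1 / 2) ≤ S.jobLaw {w | ∀ i, w i ≤ Real.log (2 * H * d) / α} := by
  have hd : (0 : ℝ) < d := by exact_mod_cast Nat.pos_of_ne_zero (NeZero.ne d)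
  have hH := h.H_pos; have hα := h.α_pos
  set B := Real.log (2 * H * d) / α with hB
  have hmeas : MeasurableSet {w : Fin d → ℝ | ∀ i, w i ≤ B} := by
    simp only [Set.ofPred_forall]
    exact MeasurableSet.iInter fun i => measurableSet_le (measurable_pi_apply i) measurable_const
  have hexp : Real.exp (α * B) = 2 * H * d := by
    rw [hB, mul_div_cancel₀ _ hα.ne', Real.exp_log (by positivity)]
  have h1 (i : Fin d) : S.jobLaw {w | B < w i} ≤ ENNReal.ofReal (1 / (2 * d)) := by
    have hint := S.integrable_exp_of_le (h.α_le i) (h.integrable i)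
    calc S.jobLaw {w | B < w i}
        ≤ ∫⁻ w, ENNReal.ofReal (Real.exp (α * w i) / (2 * H * d)) ∂S.jobLaw := by
          refine meas_le_lintegral₀ (Measurable.aemeasurable (by fun_prop)) fun w hw => ?_
          rw [ENNReal.one_le_ofReal, one_le_div (by positivity), ← hexp]
          exact Real.exp_le_exp.2 (mul_le_mul_of_nonneg_left (le_of_lt hw) hα.le)
      _ = ENNReal.ofReal ((∫ w, Real.exp (α * w i) ∂S.jobLaw) / (2 * H * d)) := by
          rw [← ofReal_integral_eq_lintegral_ofReal (hint.div_const _)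
            (ae_of_all _ fun w => by positivity), integral_div]
      _ ≤ ENNReal.ofReal (1 / (2 * d)) := by
          refine ENNReal.ofReal_le_ofReal ?_
          rw [div_le_div_iff₀ (by positivity) (by positivity)]
          have := mul_le_mul_of_nonneg_right (h.integral_exp_le (h.α_le i))
            (by positivity : 0 ≤ 2 * (d : ℝ))
          linarith
  have h2 : S.jobLaw {w | ∀ i, w i ≤ B}ᶜ ≤ ENNReal.ofReal (1 / 2) := by
    calc S.jobLaw {w | ∀ i, w i ≤ B}ᶜ ≤ S.jobLaw (⋃ i, {w | B < w i}) := by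
          refine measure_mono fun w hw => ?_
          simpa using hw
      _ ≤ ∑ i : Fin d, S.jobLaw {w | B < w i} := measure_iUnion_fintype_le _ _
      _ ≤ ∑ _i : Fin d, ENNReal.ofReal (1 / (2 * d)) := Finset.sum_le_sum fun i _ => h1 i
      _ = ENNReal.ofReal (1 / 2) := by
          rw [← ENNReal.ofReal_sum_of_nonneg fun _ _ => by positivity, Finset.sum_const,
            Finset.card_univ, Fintype.card_fin, nsmul_eq_mul]
          congr 1
          field_simp
  rw [← compl_compl {w : Fin d → ℝ | ∀ i, w i ≤ B}, prob_compl_eq_one_sub hmeas.compl]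
  refine le_trans (le_of_eq ?_) (tsub_le_tsub_left h2 1)
  rw [← ENNReal.ofReal_one, ← ENNReal.ofReal_sub _ (by norm_num)]
  norm_num

lemma le_measure_haltSet [NeZero d] (h : S.Regular δ₀ H α ζ v θ δ) (hd : 2 ≤ d) {T : ℝ}
    (hT : 0 ≤ T) :
    ENNReal.ofReal (Real.exp (-(S.rate * T)) / 4) ≤
      S.drawLaw θ (haltSet v θ (Real.log (2 * H * d) / α) T) := by
  have := fun k => S.isProbabilityMeasure_tiltedPairLaw θ k (h.integrable_exp_root k)
  have := isProbabilityMeasure_expMeasure S.rate_pos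
  have hprop := S.isProbabilityMeasure_proposalLaw θ h.integrable_exp_root
  -- A finite mean makes the walk cross almost surely.
  have hfin : S.proposalLaw θ {p | belowCount v (level θ) p.2 < ⊤} = 1 := by
    have hms : MeasurableSet {p : Fin d × (ℕ → (Fin d → ℝ) × ℝ) |
        belowCount v (level θ) p.2 < ⊤} :=
      measurableSet_lt ((measurable_belowCount v _).comp measurable_snd) measurable_const
    rw [← prob_compl_eq_zero_iff hms]
    exact ae_lt_top ((measurable_belowCount v _).comp measurable_snd)
      ((h.lintegral_belowCount_proposalLaw_le h.level_nonneg).trans_lt ENNReal.ofReal_lt_top).ne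
  -- Here `d ≥ 2` is essential: for `d = 1` the event `V > 1 / d` is null.
  have hunif : ENNReal.ofReal (1 / 2) ≤
      (volume.restrict (Set.Icc (0 : ℝ) 1)) (Set.Ioi (1 / (d : ℝ))) := by
    have hd' : (2 : ℝ) ≤ d := by exact_mod_cast hd
    have h1 : 1 / (d : ℝ) ≤ 1 / 2 := one_div_le_one_div_of_le (by norm_num) hd'
    have h0 : (0 : ℝ) ≤ 1 / d := by positivity
    have hsub : Set.Ioc (1 / (d : ℝ)) 1 ⊆ Set.Ioi (1 / (d : ℝ)) ∩ Set.Icc 0 1 :=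
      fun x hx => ⟨hx.1, h0.trans hx.1.le, hx.2⟩
    rw [Measure.restrict_apply measurableSet_Ioi]
    refine le_trans ?_ (measure_mono hsub)
    rw [Real.volume_Ioc]
    exact ENNReal.ofReal_le_ofReal (by linarith)
  rw [drawLaw, haltSet, Measure.prod_prod, Measure.prod_prod, Measure.prod_prod, hfin, one_mul,
    expMeasure_Ioi S.rate_pos hT]
  calc ENNReal.ofReal (Real.exp (-(S.rate * T)) / 4)
      = ENNReal.ofReal (1 / 2) * ENNReal.ofReal (Real.exp (-(S.rate * T))) *
          ENNReal.ofReal (1 / 2) := by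
        rw [← ENNReal.ofReal_mul (by norm_num), ← ENNReal.ofReal_mul (by positivity)]
        ring_nf
    _ ≤ _ := by
        gcongr
        exact h.half_le_measure_job_le

lemma lintegral_one_add_belowCount_le [NeZero d] (h : S.Regular δ₀ H α ζ v θ δ) {m : ℝ}
    (hm : 0 ≤ m) :
    ∫⁻ x, (1 + belowCount v m x.2.1.2) ∂(S.drawLaw θ) ≤
      ENNReal.ofReal (1 + Real.exp (H / (ζ * δ₀) * m) / stepGap δ₀ H α ζ) := by
  have := S.isProbabilityMeasure_drawLaw θ h.integrable_exp_root
  have := isProbabilityMeasure_expMeasure S.rate_pos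
  have hprop := S.isProbabilityMeasure_proposalLaw θ h.integrable_exp_root
  have hunif : IsProbabilityMeasure (volume.restrict (Set.Icc (0 : ℝ) 1)) := ⟨by simp⟩
  have hb : Measurable fun p : Fin d × (ℕ → (Fin d → ℝ) × ℝ) => belowCount v m p.2 :=
    (measurable_belowCount v m).comp measurable_snd
  have hpres : MeasurePreserving (fun x : DrawSpace d => x.2.1) (S.drawLaw θ) (S.proposalLaw θ) :=
    (measurePreserving_fst (μ := S.proposalLaw θ)
      (ν := volume.restrict (Set.Icc (0 : ℝ) 1))).comp measurePreserving_snd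
  have hstep := h.stepGap_pos
  rw [lintegral_add_left measurable_const, lintegral_const, measure_univ, mul_one,
    ENNReal.ofReal_add zero_le_one (by positivity), ENNReal.ofReal_one]
  gcongr
  rw [hpres.lintegral_comp hb]
  exact h.lintegral_belowCount_proposalLaw_le hm

lemma expectedCount_le_ofReal [NeZero d] (h : S.Regular δ₀ H α ζ v θ δ) (hd : 2 ≤ d) :
    S.expectedCount v θ ≤ ENNReal.ofReal
      (4 * Real.exp (1 / ζ * ((2 * Real.log d / rootBound δ₀ H α ζ +
          Real.log (2 * H * d) / α) / δ₀)) *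
        (1 + Real.exp (H / (ζ * δ₀) * (2 * Real.log d / rootBound δ₀ H α ζ)) /
          stepGap δ₀ H α ζ)) := by
  have hδ := h.δ₀_pos; have hα := h.α_pos; have hζ := h.ζ_pos; have hH := h.H_pos
  have hstep := h.stepGap_pos; have hroot := h.rootBound_pos
  have hd1 : (1 : ℝ) ≤ d := by exact_mod_cast (by lia : 1 ≤ d)
  have hB : 0 ≤ Real.log (2 * H * d) / α :=
    div_nonneg (Real.log_nonneg (by nlinarith [h.one_le_H])) hα.le
  have hm := h.level_nonneg
  -- The least `T` with `B + level θ ≤ T * δ₀`, hence enough for every `v i ≥ δ₀`.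
  set T := (level θ + Real.log (2 * H * d) / α) / δ₀ with hTdef
  have hT0 : 0 ≤ T := by positivity
  have hT (i : Fin d) : Real.log (2 * H * d) / α + level θ ≤ T * v i := by
    calc Real.log (2 * H * d) / α + level θ = T * δ₀ := by
          rw [hTdef, div_mul_cancel₀ _ hδ.ne']; ring
      _ ≤ T * v i := mul_le_mul_of_nonneg_left (h.le_drift i) hT0
  have h1 := expectedCount_le S h.root_pos (fun i => hδ.trans_le (h.le_drift i))
    h.le_root_mul_level hT h.integrable_exp_root
  refine h1.trans ?_
  have h2 : (S.drawLaw θ (haltSet v θ (Real.log (2 * H * d) / α) T))⁻¹ ≤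
      ENNReal.ofReal (4 * Real.exp (S.rate * T)) := by
    have h3 := ENNReal.inv_le_inv.2 (h.le_measure_haltSet hd hT0)
    refine h3.trans (le_of_eq ?_)
    rw [← ENNReal.ofReal_inv_of_pos (by positivity), Real.exp_neg]
    congr 1
    field_simp
  refine (mul_le_mul' h2 (h.lintegral_one_add_belowCount_le hm)).trans ?_
  rw [← ENNReal.ofReal_mul (by positivity)]
  refine ENNReal.ofReal_le_ofReal ?_
  have h5 := h.level_le
  have h6 := h.rate_le
  have h7 : T ≤ (2 * Real.log d / rootBound δ₀ H α ζ + Real.log (2 * H * d) / α) / δ₀ := by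
    rw [hTdef]; gcongr
  gcongr

lemma expectedCount_le_rpow [NeZero d] (h : S.Regular δ₀ H α ζ v θ δ) (hd : 2 ≤ d) :
    S.expectedCount v θ ≤ ENNReal.ofReal
      (4 * Real.exp (Real.log (2 * H) / (α * ζ * δ₀)) * (1 + 1 / stepGap δ₀ H α ζ) *
        (d : ℝ) ^ ((2 / rootBound δ₀ H α ζ + 1 / α) / (ζ * δ₀) +
          2 * H / (ζ * δ₀ * rootBound δ₀ H α ζ))) := by
  refine (h.expectedCount_le_ofReal hd).trans (ENNReal.ofReal_le_ofReal ?_)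
  have hδ := h.δ₀_pos; have hα := h.α_pos; have hζ := h.ζ_pos; have hH := h.H_pos
  have hstep := h.stepGap_pos; have hroot := h.rootBound_pos
  have hd1 : (1 : ℝ) ≤ d := by exact_mod_cast (by lia : 1 ≤ d)
  have hd0 : (0 : ℝ) < d := by linarith
  have e1 : Real.exp (1 / ζ * ((2 * Real.log d / rootBound δ₀ H α ζ +
      Real.log (2 * H * d) / α) / δ₀)) = Real.exp (Real.log (2 * H) / (α * ζ * δ₀)) *
        (d : ℝ) ^ ((2 / rootBound δ₀ H α ζ + 1 / α) / (ζ * δ₀)) := by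
    rw [Real.rpow_def_of_pos hd0, ← Real.exp_add, Real.log_mul (by positivity) hd0.ne']
    congr 1
    field_simp
    ring
  have e2 : Real.exp (H / (ζ * δ₀) * (2 * Real.log d / rootBound δ₀ H α ζ)) =
      (d : ℝ) ^ (2 * H / (ζ * δ₀ * rootBound δ₀ H α ζ)) := by
    rw [Real.rpow_def_of_pos hd0]
    congr 1
    field_simp
  have e3 : 1 ≤ (d : ℝ) ^ (2 * H / (ζ * δ₀ * rootBound δ₀ H α ζ)) :=
    Real.one_le_rpow hd1 (by positivity)
  rw [e1, e2, Real.rpow_add hd0]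
  set x := (d : ℝ) ^ (2 * H / (ζ * δ₀ * rootBound δ₀ H α ζ))
  -- Step 2's single draw is absorbed into the power of `d`, as `x ≥ 1`.
  have e4 : 1 + x / stepGap δ₀ H α ζ ≤ (1 + 1 / stepGap δ₀ H α ζ) * x := by
    rw [add_mul, one_mul, one_div_mul_eq_div]; gcongr
  refine (mul_le_mul_of_nonneg_left e4 (by positivity)).trans (le_of_eq ?_)
  ring

end Regular

end FluidNetwork

end

theorem theorem2 (δ₀ a H α ζ : ℝ) (hδ₀ : 0 < δ₀) (ha : 0 < a) (hH : 0 < H) (hα : 0 < α)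
    (hζ : 0 < ζ) :
    ∃ γ : ℝ, ∀ (S : ∀ d : ℕ, FluidNetwork d) (v θ δ : ∀ d : ℕ, Fin d → ℝ),
      -- the drift of `Z` and the Cramér roots
      (∀ d, 1 ≤ d → (S d).IsDrift δ₀ (v d)) →
      (∀ d, 1 ≤ d → (S d).IsCramerRoot (v d) (θ d)) →
      -- C1
      (∀ d, 1 ≤ d → ∀ i, ((S d).R⁻¹.mulVec (S d).meanX) i < -δ₀) →
      -- C2
      (∀ d, 1 ≤ d → ∀ i,
        Integrable (fun p => (FluidNetwork.netInput (v d) 1 p i) ^ 2) ((S d).inputLaw 1) ∧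
        ∫ p, (FluidNetwork.netInput (v d) 1 p i) ^ 2 ∂((S d).inputLaw 1) ≤ a) →
      (∀ d, 1 ≤ d → ∀ j,
        Integrable (fun w => Real.exp (δ d j * w j)) (S d).jobLaw ∧
        ∫ w, Real.exp (δ d j * w j) ∂(S d).jobLaw ≤ H) →
      (∀ d, 1 ≤ d → ∀ j, θ d j + α < δ d j) →
      -- C3
      (∀ d, 1 ≤ d → ζ ≤ (S d).rate ∧ (S d).rate ≤ 1 / ζ) →
      (∀ᶠ d in atTop, (S d).expectedCount (v d) (θ d) ≠ ⊤) ∧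
      (fun d : ℕ => ((S d).expectedCount (v d) (θ d)).toReal) =O[atTop]
        (fun d : ℕ => (d : ℝ) ^ γ) := by
  -- The first summand comes from the inverse halting probability, the second from the mean cost of
  -- a pass.
  refine ⟨(2 / FluidNetwork.rootBound δ₀ H α ζ + 1 / α) / (ζ * δ₀) +
    2 * H / (ζ * δ₀ * FluidNetwork.rootBound δ₀ H α ζ), ?_⟩
  intro S v θ δ hdrift hroot hC1 _ hC2 hδ hC3
  have hreg : ∀ d, 1 ≤ d → (S d).Regular δ₀ H α ζ (v d) (θ d) (δ d) := fun d hd =>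
    { δ₀_pos := hδ₀
      H_pos := hH
      α_pos := hα
      ζ_pos := hζ
      drift := (hdrift d hd).add_le (fun i => (S d).integrable_job
        (by linarith [(hroot d hd i).1, hδ d hd i]) (hC2 d hd i).1) (hC1 d hd)
      root_pos := fun i => (hroot d hd i).1
      root := (hroot d hd).rate_mul_eq
      integrable := fun i => (hC2 d hd i).1
      integral_le := fun i => (hC2 d hd i).2
      root_lt := hδ d hd
      rate_le := (hC3 d hd).2 }
  have hbound : ∀ d, 2 ≤ d → _ := fun d hd =>
    have : NeZero d := ⟨by lia⟩
    (hreg d (by lia)).expectedCount_le_rpow hd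
  refine ⟨?_, ?_⟩
  · filter_upwards [eventually_ge_atTop 2] with d hd
    exact ne_top_of_le_ne_top ENNReal.ofReal_ne_top (hbound d hd)
  · refine IsBigO.of_bound (4 * Real.exp (Real.log (2 * H) / (α * ζ * δ₀)) *
      (1 + 1 / FluidNetwork.stepGap δ₀ H α ζ)) ?_
    filter_upwards [eventually_ge_atTop 2] with d hd
    have hstep := (hreg d (by lia)).stepGap_pos
    rw [Real.norm_of_nonneg ENNReal.toReal_nonneg, Real.norm_of_nonneg (by positivity)]
    exact ENNReal.toReal_le_of_le_ofReal (by positivity) (hbound d hd)
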